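/- Consider the two-way amplify-and-forward relay protocol with an energy harvesting relay. Let $P_1,P_2>0$ be the transmit powers of the sources $S_1,S_2$, let $0<\lambda<1$ be the power splitting ratio and $0<\eta\le 1$ the energy conversion efficiency, let $\sigma_a^2,\sigma_b^2\ge 0$ be the noise variances with $\sigma^2=\sigma_a^2+\sigma_b^2>0$, and let the channel gains $h_1,h_2$ be independent with $h_i\sim\mathcal{CN}(0,\Omega_i)$, $\Omega_i>0$. For $\{i,j\}=\{1,2\}$, after cancelling its own signal, $S_i$ receives $$\sqrt{\eta\lambda P_j}\,h_ih_jx_j+\sqrt{\eta\lambda}\,h_in_a+\sqrt{\tfrac{\eta\lambda}{1-\lambda}}\,h_in_b+n_i,$$ where $x_j$ has unit power and $n_a,n_b,n_i$ are independent noises of variances $\sigma_a^2,\sigma_b^2,\sigma^2$. Its signal-to-noise ratio is therefore $$\gamma_i=\frac{P_j}{\sigma^2}\,\frac{|h_1|^2|h_2|^2}{b|h_i|^2+c},\qquad b=1+\frac{\sigma_b^2}{\sigma^2}\,\frac{\lambda}{1-\lambda},\qquad c=\frac1{\eta\lambda}.$$ Let $C_e=\mathbb E\big[\tfrac12\log_2(1+\gamma_1)\big]+\mathbb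 E\big[\tfrac12\log_2(1+\gamma_2)\big]$ be the ergodic sum capacity. Put $$s_i=\frac{\sigma^2b}{P_i\Omega_i},\qquad A_i=\frac{\sigma^2c}{P_i\Omega_1\Omega_2},\qquad \mathcal J_{i,l}=\int_0^\infty\frac{e^{-s_iz}z^{l+1}\ln z}{1+z}\,dz,$$ let $\mathbf C$ be Euler's constant, and let $\Psi(\alpha,\beta;z)=\frac1{\Gamma(\alpha)}\int_0^\infty e^{-zt}t^{\alpha-1}(1+t)^{\beta-\alpha-1}\,dt$ ($\alpha,z>0$) be Tricomi's confluent hypergeometric function. Then both expectations are finite, all the integrals $\mathcal J_{i,l}$ and the series below converge absolutely, and $$C_e=\frac1{2\ln2}\sum_{i=1}^2\Psi(1,1;s_i)+\frac1{2\ln2}\sum_{i=1}^2\Bigg\{\sum_{l=1}^\infty\frac{A_i^{l+1}}{l!}\bigg[\Big(\ln A_i+2\mathbf C-\sum_{k=1}^{l}\frac1k-\sum_{k=1}^{l+1}\frac1k\Big)\Psi(l+2,l+2;s_i)+\frac{\mathcal J_{i,l}}{(l+1)!}\bigg]$$ $$\qquad\qquad+A_i\big(\ln A_i+2\mathbf C-1\big)\Psi(2,2;s_i)+A_i\,\mathcal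 J_{i,0}\Bigg\}.$$ -/

import Mathlib

open MeasureTheory ProbabilityTheory
open scoped NNReal

noncomputable section

/-- The circularly symmetric complex Gaussian law `CN(0, v)`: the real and imaginary parts are
independent real Gaussians with mean `0` and variance `v / 2`. -/
def complexGaussian (v : ℝ≥0) : Measure ℂ :=
  ((gaussianReal 0 (v / 2)).prod (gaussianReal 0 (v / 2))).map
    Complex.measurableEquivRealProd.symm

/-- Tricomi's confluent hypergeometric function `Ψ(α, β; z)` for real `α > 0`, real `β` and
`z > 0`, given by `Γ(α) Ψ(α, β; z) = ∫₀^∞ e^{-zt} t^{α-1} (1+t)^{β-α-1} dt`. -/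
def tricomiPsi (α β z : ℝ) : ℝ :=
  (Real.Gamma α)⁻¹ *
    ∫ t in Set.Ioi (0 : ℝ), Real.exp (-(z * t)) * t ^ (α - 1) * (1 + t) ^ (β - α - 1)

/-- Parameters of the two-way amplify-and-forward relaying protocol with an energy harvesting
(power splitting) relay. The sources `S₁`, `S₂` are indexed by `Fin 2`. -/
structure TwoWayRelay where
  /-- transmit powers of the two sources -/
  P : Fin 2 → ℝ
  /-- variances of the channel gains -/
  chanVar : Fin 2 → ℝ≥0
  /-- energy conversion efficiency -/
  eta : ℝ
  /-- power splitting ratio -/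
  lam : ℝ
  /-- variance of the antenna noise -/
  varA : ℝ
  /-- variance of the conversion noise -/
  varB : ℝ
  P_pos : ∀ i, 0 < P i
  chanVar_pos : ∀ i, 0 < chanVar i
  eta_pos : 0 < eta
  eta_le_one : eta ≤ 1
  lam_pos : 0 < lam
  lam_lt_one : lam < 1
  varA_nonneg : 0 ≤ varA
  varB_nonneg : 0 ≤ varB
  noise_pos : 0 < varA + varB

namespace TwoWayRelay

variable (T : TwoWayRelay)

/-- Total noise power `σ² = σ_a² + σ_b²`; this is also the noise variance at either source. -/
def var : ℝ := T.varA + T.varB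

/-- `ε = σ_b² / (σ_a² + σ_b²)`. -/
def eps : ℝ := T.varB / (T.varA + T.varB)

/-- `b = 1 + ε λ / (1 - λ)`. -/
def b : ℝ := 1 + T.eps * T.lam / (1 - T.lam)

/-- `c = 1 / (η λ)`. -/
def c : ℝ := 1 / (T.eta * T.lam)

/-- The SNR `γ_i` at the source `S_i` for channel gains `h`. After cancellation of the self
interference, `S_i` receives, with `j` the other source,
`√(ηλP_j) h_i h_j x_j + √(ηλ) h_i n_a + √(ηλ/(1-λ)) h_i n_b + n_i`,
where `x_j` has unit power and `n_a`, `n_b`, `n_i` are independent noises of variances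
`σ_a²`, `σ_b²`, `σ²`. The SNR is the signal power divided by the noise power. -/
def snr (i : Fin 2) (h : Fin 2 → ℂ) : ℝ :=
  ‖(√(T.eta * T.lam * T.P (1 - i)) : ℂ) * h i * h (1 - i)‖ ^ 2 /
    (‖(√(T.eta * T.lam) : ℂ) * h i‖ ^ 2 * T.varA
      + ‖(√(T.eta * T.lam / (1 - T.lam)) : ℂ) * h i‖ ^ 2 * T.varB
      + T.var)

/-- The closed form `γ_i = (P_j / σ²) |h_i|² |h_j|² / (b |h_i|² + c)` of the SNR. -/
theorem snr_eq (i : Fin 2) (h : Fin 2 → ℂ) :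
    T.snr i h = T.P (1 - i) / T.var *
      (‖h i‖ ^ 2 * ‖h (1 - i)‖ ^ 2 / (T.b * ‖h i‖ ^ 2 + T.c)) := by
  have h1 := T.eta_pos
  have h2 := T.lam_pos
  have h3 : 0 < 1 - T.lam := sub_pos.2 T.lam_lt_one
  have h4 := T.noise_pos
  have h5 := (T.P_pos (1 - i)).le
  have h6 := T.varA_nonneg
  have h7 := T.varB_nonneg
  have e1 : √(T.eta * T.lam * T.P (1 - i)) ^ 2 = T.eta * T.lam * T.P (1 - i) :=
    Real.sq_sqrt (by positivity)
  have e2 : √(T.eta * T.lam) ^ 2 = T.eta * T.lam := Real.sq_sqrt (by positivity)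
  have e3 : √(T.eta * T.lam / (1 - T.lam)) ^ 2 = T.eta * T.lam / (1 - T.lam) :=
    Real.sq_sqrt (by positivity)
  have d1 : T.eta * T.lam * ‖h i‖ ^ 2 * T.varA
      + T.eta * T.lam / (1 - T.lam) * ‖h i‖ ^ 2 * T.varB + (T.varA + T.varB)
      = (T.varA + T.varB) * (T.eta * T.lam) * (T.b * ‖h i‖ ^ 2 + T.c) := by
    unfold b c eps
    field_simp
    ring
  have hb : 0 < T.b * ‖h i‖ ^ 2 + T.c := by
    have : 0 ≤ T.b := by unfold b eps; positivity
    have : 0 < T.c := by unfold c; positivity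
    positivity
  unfold snr var
  simp only [norm_mul, mul_pow, Complex.norm_real, Real.norm_eq_abs, sq_abs, e1, e2, e3]
  rw [d1]
  field_simp

/-- The data rate `R_i = (1/2) log₂ (1 + γ_i)` at `S_i`. -/
def rate (i : Fin 2) (h : Fin 2 → ℂ) : ℝ := 1 / 2 * Real.logb 2 (1 + T.snr i h)

/-- The ergodic sum capacity `C_e = E[R₁] + E[R₂]` for random channel gains `h`. -/
def ergodicCapacity {S : Type*} [MeasurableSpace S] (μ : Measure S) (h : Fin 2 → S → ℂ) : ℝ :=
  ∑ i : Fin 2, ∫ ω, T.rate i (fun k => h k ω) ∂μ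

/-- `σ² b / (P_i Ω_i)`. -/
def psiArg (i : Fin 2) : ℝ := T.var * T.b / (T.P i * T.chanVar i)

/-- `σ² c / (P_i Ω₁ Ω₂)`. -/
def ratio (i : Fin 2) : ℝ := T.var * T.c / (T.P i * T.chanVar 0 * T.chanVar 1)

/-- The integrand of the residual integral `J_{i,l}`. -/
def residualIntegrand (i : Fin 2) (l : ℕ) (z : ℝ) : ℝ :=
  Real.exp (-(T.psiArg i * z)) * z ^ (l + 1) * Real.log z / (1 + z)

/-- The residual integral
`J_{i,l} = ∫₀^∞ exp(-σ²bz/(P_iΩ_i)) z^{l+1} ln z / (1+z) dz`. -/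
def residualIntegral (i : Fin 2) (l : ℕ) : ℝ :=
  ∫ z in Set.Ioi (0 : ℝ), T.residualIntegrand i l z

/-- The `l`-th term of the series of the capacity formula. -/
def seriesTerm (i : Fin 2) (l : ℕ) : ℝ :=
  T.ratio i ^ (l + 1) / (l.factorial : ℝ) *
    ((Real.log (T.ratio i) + 2 * Real.eulerMascheroniConstant
        - ∑ k ∈ Finset.Icc 1 l, 1 / (k : ℝ) - ∑ k ∈ Finset.Icc 1 (l + 1), 1 / (k : ℝ))
      * tricomiPsi ((l : ℝ) + 2) ((l : ℝ) + 2) (T.psiArg i)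
      + 1 / ((l + 1).factorial : ℝ) * T.residualIntegral i l)

end TwoWayRelay

end

/-!
Given `|h_i|² = x`, the event `γ_i > z` says that the exponential variable `|h_j|²` exceeds
`(σ² / P_j) z (b + c / x)`, so averaging over `x` gives `P(γ_i > z) = e^{-sz} M₀(Az)` with
`M₀(y) = ∫₀^∞ e^{-u-y/u} du = 2√y K₁(2√y)`, and the layer-cake formula turns `E[ln (1 + γ_i)]` into
`∫₀^∞ e^{-sz} M₀(Az) / (1+z) dz`. The series is the expansion of `M₀` at `0`, integrated termwise.
Since `y M₀'' = M₀`, the remainders of this expansion satisfy `y R_{n+1}'' = R_n`, and both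
`R_{n+1}` and `R_{n+1}'` vanish at `0⁺`; integrating twice from `0` gives
`|R_n(y)| ≤ C y^{a+n} / (Γ(a+n) Γ(a+n+1))` on the whole half-line, for any fixed `0 < a < 1`. The
integral of this bound at `y = Az` against `e^{-sz} / (1+z)` is `O((A/s)^n / Γ(a+n))`, which is
summable in `n`.
-/

noncomputable section

open Filter Topology Set

lemma le_of_tendsto_nhdsGT_of_hasDerivAt_nonneg {f f' : ℝ → ℝ} {a c : ℝ}
    (hf : ∀ x, a < x → HasDerivAt f (f' x) x) (hf' : ∀ x, a < x → 0 ≤ f' x)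
    (hlim : Tendsto f (𝓝[>] a) (𝓝 c)) {x : ℝ} (hx : a < x) : c ≤ f x := by
  have hmono : MonotoneOn f (Ioi a) := by
    refine monotoneOn_of_deriv_nonneg (convex_Ioi a)
      (fun y hy => (hf y hy).continuousAt.continuousWithinAt)
      (fun y hy => (hf y (interior_subset hy)).differentiableAt.differentiableWithinAt)
      fun y hy => ?_
    rw [(hf y (interior_subset hy)).deriv]
    exact hf' y (interior_subset hy)
  refine le_of_tendsto hlim ?_
  filter_upwards [Ioo_mem_nhdsGT hx] with y hy using hmono hy.1 hx hy.2.le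

lemma tendsto_rpow_nhdsGT_zero {a : ℝ} (ha : 0 < a) :
    Tendsto (fun x : ℝ => x ^ a) (𝓝[>] 0) (𝓝 0) := by
  have h := (Real.continuousAt_rpow_const 0 a (Or.inr ha.le)).tendsto
  rw [Real.zero_rpow ha.ne'] at h
  exact h.mono_left nhdsWithin_le_nhds

lemma abs_le_rpow_of_hasDerivAt {f f' : ℝ → ℝ} {C a : ℝ} (ha : 0 < a)
    (hf : ∀ x, 0 < x → HasDerivAt f (f' x) x) (hf' : ∀ x, 0 < x → |f' x| ≤ C * x ^ (a - 1))
    (hlim : Tendsto f (𝓝[>] 0) (𝓝 0)) {x : ℝ} (hx : 0 < x) : |f x| ≤ C / a * x ^ a := by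
  have hpow : ∀ y : ℝ, 0 < y → HasDerivAt (fun y => C / a * y ^ a) (C * y ^ (a - 1)) y :=
    fun y hy => ((Real.hasDerivAt_rpow_const (Or.inl hy.ne')).const_mul (C / a)).congr_deriv
      (by field_simp)
  have hpow_lim : Tendsto (fun y : ℝ => C / a * y ^ a) (𝓝[>] 0) (𝓝 0) := by
    simpa using (tendsto_rpow_nhdsGT_zero ha).const_mul (C / a)
  have hsub : 0 - 0 ≤ C / a * x ^ a - f x :=
    le_of_tendsto_nhdsGT_of_hasDerivAt_nonneg (fun y hy => (hpow y hy).sub (hf y hy))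
      (fun y hy => sub_nonneg.2 (le_of_abs_le (hf' y hy))) (hpow_lim.sub hlim) hx
  have hadd : 0 + 0 ≤ C / a * x ^ a + f x :=
    le_of_tendsto_nhdsGT_of_hasDerivAt_nonneg (fun y hy => (hpow y hy).add (hf y hy))
      (fun y hy => by linarith [neg_le_of_abs_le (hf' y hy)]) (hpow_lim.add hlim) hx
  exact abs_le.2 ⟨by linarith, by linarith⟩

lemma abs_le_rpow_of_mul_deriv_deriv_eq {f f' g : ℝ → ℝ} {C a : ℝ} (ha : 0 < a)
    (hf : ∀ x, 0 < x → HasDerivAt f (f' x) x) (hf' : ∀ x, 0 < x → HasDerivAt f' (g x / x) x)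
    (hlim : Tendsto f (𝓝[>] 0) (𝓝 0)) (hlim' : Tendsto f' (𝓝[>] 0) (𝓝 0))
    (hg : ∀ x, 0 < x → |g x| ≤ C * x ^ a) {x : ℝ} (hx : 0 < x) :
    |f x| ≤ C / (a * (a + 1)) * x ^ (a + 1) := by
  have hg' : ∀ y, 0 < y → |g y / y| ≤ C * y ^ (a - 1) := fun y hy => by
    rw [abs_div, abs_of_pos hy, Real.rpow_sub_one hy.ne', ← mul_div_assoc]
    gcongr
    exact hg y hy
  have hbound : ∀ y, 0 < y → |f' y| ≤ C / a * y ^ (a + 1 - 1) := fun y hy => by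
    rw [add_sub_cancel_right]
    exact abs_le_rpow_of_hasDerivAt ha hf' hg' hlim' hy
  rw [← div_div]
  exact abs_le_rpow_of_hasDerivAt (by positivity) hf hbound hlim hx

lemma hasSum_of_abs_sub_sum_range_le {f bound : ℕ → ℝ} {S : ℝ} (hbound : Summable bound)
    (h : ∀ n, |S - ∑ i ∈ Finset.range n, f i| ≤ bound n) : HasSum f S := by
  have hterm : ∀ n, ‖f n‖ ≤ bound n + bound (n + 1) := fun n => by
    have hdiff : f n = (S - ∑ i ∈ Finset.range n, f i) - (S - ∑ i ∈ Finset.range (n + 1), f i) := by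
      rw [Finset.sum_range_succ]
      ring
    rw [hdiff]
    exact (norm_sub_le _ _).trans (add_le_add (h n) (h (n + 1)))
  have hsummable : Summable f :=
    .of_norm_bounded (hbound.add ((summable_nat_add_iff 1).2 hbound)) hterm
  rw [hsummable.hasSum_iff_tendsto_nat, tendsto_iff_norm_sub_tendsto_zero]
  refine squeeze_zero (fun n => norm_nonneg _) (fun n => ?_) hbound.tendsto_atTop_zero
  rw [norm_sub_rev]
  exact h n

lemma summable_rpow_add_div_Gamma {a x : ℝ} (ha : 0 < a) (hx : 0 < x) :
    Summable fun n : ℕ => x ^ (a + n) / Real.Gamma (a + n) := by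
  have hpos : ∀ n : ℕ, 0 < x ^ (a + n) / Real.Gamma (a + n) := fun n =>
    div_pos (Real.rpow_pos_of_pos hx _) (Real.Gamma_pos_of_pos (by positivity))
  refine summable_of_ratio_test_tendsto_lt_one zero_lt_one
    (Eventually.of_forall fun n => (hpos n).ne') ?_
  have hratio : ∀ n : ℕ, ‖x ^ (a + (n + 1 : ℕ)) / Real.Gamma (a + (n + 1 : ℕ))‖ /
      ‖x ^ (a + n) / Real.Gamma (a + n)‖ = x / (a + n) := fun n => by
    have han : 0 < a + n := by positivity
    rw [Real.norm_of_nonneg (hpos n).le, Real.norm_of_nonneg (hpos (n + 1)).le, Nat.cast_succ,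
      ← add_assoc, Real.rpow_add_one hx.ne', Real.Gamma_add_one han.ne']
    field_simp
  simp only [hratio]
  exact (tendsto_atTop_add_const_left _ a tendsto_natCast_atTop_atTop).const_div_atTop x

lemma abs_log_le_rpow_neg_div_add {ε x : ℝ} (hε : 0 < ε) (hx : 0 < x) :
    |Real.log x| ≤ x ^ (-ε) / ε + x := by
  have hpow : 0 ≤ x ^ (-ε) / ε := by positivity
  have hinv := Real.log_le_rpow_div (inv_pos.2 hx).le hε
  rw [Real.log_inv, Real.inv_rpow hx.le, ← Real.rpow_neg hx.le] at hinv
  exact abs_le.2 ⟨by linarith, by linarith [Real.log_le_sub_one_of_pos hx]⟩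

lemma integrableOn_exp_neg_mul_mul_rpow {s a : ℝ} (hs : 0 < s) (ha : -1 < a) :
    IntegrableOn (fun x : ℝ => Real.exp (-(s * x)) * x ^ a) (Ioi 0) := by
  simpa only [Real.rpow_one, neg_mul, mul_comm (_ ^ a)] using
    integrableOn_rpow_mul_exp_neg_mul_rpow ha one_pos hs

lemma integrableOn_exp_neg_mul_mul_rpow_mul_log {s a : ℝ} (hs : 0 < s) (ha : -1 < a) :
    IntegrableOn (fun x : ℝ => Real.exp (-(s * x)) * x ^ a * Real.log x) (Ioi 0) := by
  obtain ⟨ε, hε, hεa⟩ : ∃ ε, 0 < ε ∧ ε < a + 1 := exists_between (by linarith)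
  have hneg := (integrableOn_exp_neg_mul_mul_rpow hs (a := a - ε) (by linarith)).div_const ε
  have hpos := integrableOn_exp_neg_mul_mul_rpow hs (a := a + 1) (by linarith)
  refine Integrable.mono' (hneg.add hpos) (Measurable.aestronglyMeasurable (by fun_prop)) ?_
  filter_upwards [ae_restrict_mem measurableSet_Ioi] with x (hx : 0 < x)
  rw [norm_mul, Real.norm_of_nonneg (by positivity), Real.norm_eq_abs]
  calc Real.exp (-(s * x)) * x ^ a * |Real.log x|
      ≤ Real.exp (-(s * x)) * x ^ a * (x ^ (-ε) / ε + x) := by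
        gcongr
        exact abs_log_le_rpow_neg_div_add hε hx
    _ = Real.exp (-(s * x)) * x ^ (a - ε) / ε + Real.exp (-(s * x)) * x ^ (a + 1) := by
        rw [sub_eq_add_neg, Real.rpow_add hx, Real.rpow_add_one hx.ne']
        ring

/-- The kernel `e^{-u-y/u}`, whose integral over `u > 0` is `2√y K₁(2√y)`. -/
def besselKernel (y u : ℝ) : ℝ := Real.exp (-u - y / u)

/-- The negative moment `∫₀^∞ u⁻ⁿ e^{-u-y/u} du`, which for `y > 0` equals
`2 y^{(1-n)/2} K_{n-1}(2√y)`. -/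
def besselMoment (n : ℕ) (y : ℝ) : ℝ := ∫ u in Ioi (0 : ℝ), besselKernel y u / u ^ n

/-- The logarithmic moment `∫₀^∞ ln u e^{-u-y/u} du`. -/
def logBesselMoment (y : ℝ) : ℝ := ∫ u in Ioi (0 : ℝ), Real.log u * besselKernel y u

lemma besselKernel_pos (y u : ℝ) : 0 < besselKernel y u := Real.exp_pos _

@[fun_prop]
lemma measurable_besselKernel (y : ℝ) : Measurable (besselKernel y) := by
  unfold besselKernel
  fun_prop

lemma besselKernel_div_self {y : ℝ} (hy : y ≠ 0) (u : ℝ) :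
    besselKernel y (y / u) = besselKernel y u := by
  rw [besselKernel, besselKernel, div_div_cancel₀ hy, sub_eq_add_neg, add_comm, ← sub_eq_add_neg]

lemma besselKernel_le_exp_neg {y u : ℝ} (hy : 0 ≤ y) (hu : 0 ≤ u) :
    besselKernel y u ≤ Real.exp (-u) :=
  Real.exp_le_exp.2 (sub_le_self _ (div_nonneg hy hu))

lemma besselKernel_div_pow_le (n : ℕ) {a y u : ℝ} (ha : 0 < a) (hay : a ≤ y) (hu : 0 < u) :
    besselKernel y u / u ^ n ≤ n.factorial / a ^ n * Real.exp (-u) := by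
  have hexp : (a / u) ^ n / n.factorial ≤ Real.exp (a / u) :=
    Real.pow_div_factorial_le_exp _ (by positivity) n
  have hle : besselKernel y u ≤ Real.exp (-u) * (Real.exp (a / u))⁻¹ := by
    rw [← Real.exp_neg, ← Real.exp_add, ← sub_eq_add_neg]
    unfold besselKernel
    gcongr
  calc besselKernel y u / u ^ n
      ≤ Real.exp (-u) * (Real.exp (a / u))⁻¹ / u ^ n := by gcongr
    _ ≤ Real.exp (-u) * ((a / u) ^ n / n.factorial)⁻¹ / u ^ n := by gcongr
    _ = n.factorial / a ^ n * Real.exp (-u) := by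
        rw [div_pow]
        field_simp

lemma integrableOn_besselKernel_div_pow (n : ℕ) {y : ℝ} (hy : 0 < y) :
    IntegrableOn (fun u => besselKernel y u / u ^ n) (Ioi 0) := by
  refine Integrable.mono' ((integrableOn_exp_neg_Ioi 0).const_mul (n.factorial / y ^ n))
    (Measurable.aestronglyMeasurable (by fun_prop)) ?_
  filter_upwards [ae_restrict_mem measurableSet_Ioi] with u (hu : 0 < u)
  rw [Real.norm_of_nonneg (div_nonneg (besselKernel_pos y u).le (by positivity))]
  exact besselKernel_div_pow_le n hy le_rfl hu

lemma integrableOn_besselKernel {y : ℝ} (hy : 0 < y) : IntegrableOn (besselKernel y) (Ioi 0) := by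
  simpa only [pow_zero, div_one] using integrableOn_besselKernel_div_pow 0 hy

lemma besselMoment_zero_eq (y : ℝ) : besselMoment 0 y = ∫ u in Ioi (0 : ℝ), besselKernel y u := by
  simp only [besselMoment, pow_zero, div_one]

lemma besselMoment_zero_nonneg (y : ℝ) : 0 ≤ besselMoment 0 y := by
  rw [besselMoment_zero_eq]
  exact integral_nonneg fun u => (besselKernel_pos y u).le

lemma besselMoment_zero_le_one {y : ℝ} (hy : 0 < y) : besselMoment 0 y ≤ 1 := by
  rw [← integral_exp_neg_Ioi_zero, besselMoment_zero_eq]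
  exact setIntegral_mono_on (integrableOn_besselKernel hy) (integrableOn_exp_neg_Ioi 0)
    measurableSet_Ioi fun u hu => besselKernel_le_exp_neg hy.le (le_of_lt hu)

lemma hasDerivAt_besselMoment (n : ℕ) {y : ℝ} (hy : 0 < y) :
    HasDerivAt (besselMoment n) (-besselMoment (n + 1) y) y := by
  rw [besselMoment, ← integral_neg]
  refine (hasDerivAt_integral_of_dominated_loc_of_deriv_le (μ := volume.restrict (Ioi (0 : ℝ)))
    (F := fun x u => besselKernel x u / u ^ n)
    (F' := fun x u => -(besselKernel x u / u ^ (n + 1)))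
    (bound := fun u => (n + 1).factorial / (y / 2) ^ (n + 1) * Real.exp (-u))
    (Ioi_mem_nhds (half_lt_self hy))
    (Eventually.of_forall fun x => Measurable.aestronglyMeasurable (by fun_prop))
    (integrableOn_besselKernel_div_pow n hy) (Measurable.aestronglyMeasurable (by fun_prop))
    ?_ ((integrableOn_exp_neg_Ioi 0).const_mul _) ?_).2
  · filter_upwards [ae_restrict_mem measurableSet_Ioi] with u (hu : 0 < u) x hx
    rw [norm_neg, Real.norm_of_nonneg (div_nonneg (besselKernel_pos x u).le (by positivity))]
    exact besselKernel_div_pow_le (n + 1) (half_pos hy) (le_of_lt hx) hu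
  · filter_upwards [ae_restrict_mem measurableSet_Ioi] with u (hu : 0 < u) x _
    have hexponent : HasDerivAt (fun x : ℝ => -u - x / u) (-(1 / u)) x :=
      ((hasDerivAt_id x).div_const u).const_sub (-u)
    refine (hexponent.exp.div_const (u ^ n)).congr_deriv ?_
    rw [besselKernel, pow_succ]
    field_simp

lemma integral_div_sq_mul_comp_div (g : ℝ → ℝ) {y : ℝ} (hy : 0 < y) :
    ∫ u in Ioi (0 : ℝ), y / u ^ 2 * g (y / u) = ∫ t in Ioi (0 : ℝ), g t := by
  have hinv := integral_comp_rpow_Ioi (fun t => g (y * t)) (p := -1) (by norm_num)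
  rw [integral_comp_mul_left_Ioi g 0 hy, mul_zero, smul_eq_mul, eq_inv_mul_iff_mul_eq₀ hy.ne']
    at hinv
  rw [← hinv, ← integral_const_mul]
  refine setIntegral_congr_fun measurableSet_Ioi fun u (hu : 0 < u) => ?_
  have hpow : u ^ ((-1 : ℝ) - 1) = (u ^ 2)⁻¹ := by
    rw [show (-1 : ℝ) - 1 = -(2 : ℕ) by norm_num, Real.rpow_neg hu.le, Real.rpow_natCast]
  simp only [hpow, Real.rpow_neg_one, abs_neg, abs_one, smul_eq_mul, div_eq_mul_inv]
  ring

lemma mul_besselMoment_two {y : ℝ} (hy : 0 < y) : y * besselMoment 2 y = besselMoment 0 y := by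
  rw [besselMoment_zero_eq, besselMoment, ← integral_div_sq_mul_comp_div (besselKernel y) hy,
    ← integral_const_mul]
  congr 1 with u
  rw [besselKernel_div_self hy.ne']
  ring

lemma one_sub_exp_neg_le_rpow {a x : ℝ} (ha : 0 ≤ a) (ha' : a ≤ 1) (hx : 0 < x) :
    1 - Real.exp (-x) ≤ x ^ a := by
  rcases le_total x 1 with h | h
  · have hpow := Real.rpow_le_rpow_of_exponent_ge hx h ha'
    rw [Real.rpow_one] at hpow
    linarith [Real.one_sub_le_exp_neg x]
  · linarith [Real.one_le_rpow h ha, Real.exp_pos (-x)]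

lemma abs_besselMoment_zero_sub_one_le {a y : ℝ} (ha : 0 ≤ a) (ha' : a < 1) (hy : 0 < y) :
    |besselMoment 0 y - 1| ≤ Real.Gamma (1 - a) * y ^ a := by
  have hsplit : besselMoment 0 y - 1
      = -∫ u in Ioi (0 : ℝ), Real.exp (-u) * (1 - Real.exp (-(y / u))) := by
    have hsub := integral_sub (integrableOn_besselKernel hy) (integrableOn_exp_neg_Ioi 0)
    rw [integral_exp_neg_Ioi_zero, ← besselMoment_zero_eq] at hsub
    rw [← hsub, ← integral_neg]
    congr 1 with u
    rw [besselKernel, sub_eq_add_neg (-u), Real.exp_add]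
    ring
  rw [hsplit, abs_neg, Real.Gamma_eq_integral (by linarith), ← integral_mul_const,
    ← Real.norm_eq_abs]
  refine norm_integral_le_of_norm_le
    ((Real.GammaIntegral_convergent (s := 1 - a) (by linarith)).mul_const (y ^ a)) ?_
  filter_upwards [ae_restrict_mem measurableSet_Ioi] with u (hu : 0 < u)
  have hle_one : Real.exp (-(y / u)) ≤ 1 := Real.exp_le_one_iff.2 (neg_nonpos.2 (by positivity))
  rw [norm_mul, Real.norm_of_nonneg (Real.exp_pos _).le, Real.norm_of_nonneg (sub_nonneg.2 hle_one)]
  calc Real.exp (-u) * (1 - Real.exp (-(y / u)))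
      ≤ Real.exp (-u) * (y / u) ^ a := by
        gcongr
        exact one_sub_exp_neg_le_rpow ha ha'.le (by positivity)
    _ = Real.exp (-u) * u ^ (1 - a - 1) * y ^ a := by
        rw [Real.div_rpow hy.le hu.le, show 1 - a - 1 = -a by ring, Real.rpow_neg hu.le]
        ring

lemma integrableOn_log_mul_exp_neg :
    IntegrableOn (fun u : ℝ => Real.log u * Real.exp (-u)) (Ioi 0) := by
  simpa only [one_mul, Real.rpow_zero, mul_one, mul_comm] using
    integrableOn_exp_neg_mul_mul_rpow_mul_log one_pos (a := 0) (by norm_num)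

lemma integral_log_mul_exp_neg :
    ∫ u in Ioi (0 : ℝ), Real.log u * Real.exp (-u) = -Real.eulerMascheroniConstant := by
  have hGamma : Complex.Gamma =ᶠ[𝓝 1] Complex.GammaIntegral := by
    filter_upwards [(isOpen_lt continuous_const Complex.continuous_re).mem_nhds
      (show (0 : ℝ) < (1 : ℂ).re by simp)] with s hs using Complex.Gamma_eq_integral hs
  have hderiv := ((Complex.hasDerivAt_GammaIntegral (s := 1) (by simp)).congr_of_eventuallyEq
    hGamma).unique Complex.hasDerivAt_Gamma_one
  simp only [sub_self, Complex.cpow_zero, one_mul, ← Complex.ofReal_mul] at hderiv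
  rw [integral_complex_ofReal] at hderiv
  exact_mod_cast hderiv

lemma integrableOn_log_mul_besselKernel_div_pow (n : ℕ) {y : ℝ} (hy : 0 < y) :
    IntegrableOn (fun u => Real.log u * (besselKernel y u / u ^ n)) (Ioi 0) := by
  refine Integrable.mono' (integrableOn_log_mul_exp_neg.norm.const_mul (n.factorial / y ^ n))
    (Measurable.aestronglyMeasurable (by fun_prop)) ?_
  filter_upwards [ae_restrict_mem measurableSet_Ioi] with u (hu : 0 < u)
  rw [norm_mul, norm_mul, mul_left_comm, Real.norm_of_nonneg (Real.exp_pos _).le,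
    Real.norm_of_nonneg (div_nonneg (besselKernel_pos y u).le (by positivity))]
  gcongr
  exact besselKernel_div_pow_le n hy le_rfl hu

lemma integrableOn_log_mul_besselKernel {y : ℝ} (hy : 0 < y) :
    IntegrableOn (fun u => Real.log u * besselKernel y u) (Ioi 0) := by
  simpa only [pow_zero, div_one] using integrableOn_log_mul_besselKernel_div_pow 0 hy

lemma tendsto_logBesselMoment :
    Tendsto logBesselMoment (𝓝[>] 0) (𝓝 (-Real.eulerMascheroniConstant)) := by
  rw [← integral_log_mul_exp_neg]
  refine tendsto_integral_filter_of_dominated_convergence _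
    (Eventually.of_forall fun y => Measurable.aestronglyMeasurable (by fun_prop)) ?_
    integrableOn_log_mul_exp_neg.norm (Eventually.of_forall fun u => ?_)
  · filter_upwards [self_mem_nhdsWithin] with y (hy : 0 < y)
    filter_upwards [ae_restrict_mem measurableSet_Ioi] with u (hu : 0 < u)
    rw [norm_mul, norm_mul, Real.norm_of_nonneg (besselKernel_pos y u).le,
      Real.norm_of_nonneg (Real.exp_pos _).le]
    gcongr
    exact besselKernel_le_exp_neg hy.le hu.le
  · have hcont : Continuous fun y => Real.log u * besselKernel y u := by
      unfold besselKernel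
      fun_prop
    simpa only [besselKernel, zero_div, sub_zero] using
      (hcont.tendsto 0).mono_left nhdsWithin_le_nhds

lemma hasDerivAt_besselKernel (y : ℝ) {u : ℝ} (hu : u ≠ 0) :
    HasDerivAt (besselKernel y) (y / u ^ 2 * besselKernel y u - besselKernel y u) u := by
  have hexponent : HasDerivAt (fun u : ℝ => -u - y / u) (-1 - (0 * u - y * 1) / u ^ 2) u :=
    (hasDerivAt_id u).neg.sub ((hasDerivAt_const u y).div (hasDerivAt_id u) hu)
  refine hexponent.exp.congr_deriv ?_
  rw [besselKernel]
  ring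

lemma tendsto_besselKernel_atTop {y : ℝ} (hy : 0 ≤ y) :
    Tendsto (besselKernel y) atTop (𝓝 0) := by
  refine squeeze_zero' (Eventually.of_forall fun u => (besselKernel_pos y u).le) ?_
    Real.tendsto_exp_neg_atTop_nhds_zero
  filter_upwards [eventually_ge_atTop 0] with u hu using besselKernel_le_exp_neg hy hu

lemma tendsto_log_mul_besselKernel_atTop {y : ℝ} (hy : 0 ≤ y) :
    Tendsto (fun u => Real.log u * besselKernel y u) atTop (𝓝 0) := by
  have hlim : Tendsto (fun u : ℝ => u ^ 1 * Real.exp (-u)) atTop (𝓝 0) :=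
    Real.tendsto_pow_mul_exp_neg_atTop_nhds_zero 1
  refine squeeze_zero' ?_ ?_ hlim
  · filter_upwards [eventually_ge_atTop 1] with u hu using
      mul_nonneg (Real.log_nonneg hu) (besselKernel_pos y u).le
  · filter_upwards [eventually_ge_atTop 0] with u hu
    rw [pow_one]
    exact mul_le_mul (Real.log_le_self hu) (besselKernel_le_exp_neg hy hu)
      (besselKernel_pos y u).le hu

lemma tendsto_log_mul_besselKernel_nhdsGT_zero {y : ℝ} (hy : 0 < y) :
    Tendsto (fun u => Real.log u * besselKernel y u) (𝓝[>] 0) (𝓝 0) := by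
  have hdiv : Tendsto (fun u => y / u) (𝓝[>] 0) atTop := by
    simpa only [div_eq_mul_inv] using tendsto_inv_nhdsGT_zero.const_mul_atTop hy
  have hlim := (((tendsto_besselKernel_atTop hy.le).const_mul (Real.log y)).sub
    (tendsto_log_mul_besselKernel_atTop hy.le)).comp hdiv
  rw [mul_zero, sub_zero] at hlim
  refine hlim.congr' ?_
  filter_upwards [self_mem_nhdsWithin] with u (hu : 0 < u)
  rw [Function.comp_apply, besselKernel_div_self hy.ne', Real.log_div hy.ne' hu.ne']
  ring

lemma integral_div_sq_mul_log_mul_besselKernel {y : ℝ} (hy : 0 < y) :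
    ∫ u in Ioi (0 : ℝ), y / u ^ 2 * (Real.log u * besselKernel y u)
      = Real.log y * besselMoment 0 y - logBesselMoment y := by
  rw [besselMoment_zero_eq, logBesselMoment, ← integral_const_mul,
    ← integral_sub ((integrableOn_besselKernel hy).const_mul _)
      (integrableOn_log_mul_besselKernel hy),
    ← integral_div_sq_mul_comp_div (fun u => Real.log y * besselKernel y u
      - Real.log u * besselKernel y u) hy]
  refine setIntegral_congr_fun measurableSet_Ioi fun u (hu : 0 < u) => ?_
  simp only [besselKernel_div_self hy.ne', Real.log_div hy.ne' hu.ne']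
  ring

lemma besselMoment_one_eq {y : ℝ} (hy : 0 < y) :
    besselMoment 1 y = 2 * logBesselMoment y - Real.log y * besselMoment 0 y := by
  have hint : IntegrableOn (fun u => y / u ^ 2 * (Real.log u * besselKernel y u)) (Ioi 0) := by
    refine ((integrableOn_log_mul_besselKernel_div_pow 2 hy).const_mul y).congr
      (Eventually.of_forall fun u => ?_)
    simp only
    ring
  have hexpand : ∀ u, Real.log u * (y / u ^ 2 * besselKernel y u - besselKernel y u)
      = y / u ^ 2 * (Real.log u * besselKernel y u) - Real.log u * besselKernel y u :=
    fun u => by ring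
  have hparts := integral_Ioi_mul_deriv_eq_deriv_mul (fun u hu => Real.hasDerivAt_log (ne_of_gt hu))
    (fun u hu => hasDerivAt_besselKernel y (ne_of_gt hu))
    ((hint.sub (integrableOn_log_mul_besselKernel hy)).congr
      (Eventually.of_forall fun u => (hexpand u).symm))
    ((integrableOn_besselKernel_div_pow 1 hy).congr
      (Eventually.of_forall fun u => by simp only [Pi.mul_apply, pow_one]; ring))
    (tendsto_log_mul_besselKernel_nhdsGT_zero hy) (tendsto_log_mul_besselKernel_atTop hy.le)
  simp only [hexpand, ← div_eq_inv_mul] at hparts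
  rw [integral_sub hint (integrableOn_log_mul_besselKernel hy),
    integral_div_sq_mul_log_mul_besselKernel hy, ← logBesselMoment] at hparts
  simp only [besselMoment, pow_one] at hparts ⊢
  linarith

lemma tendsto_besselMoment_zero_sub_one :
    Tendsto (fun y => besselMoment 0 y - 1) (𝓝[>] 0) (𝓝 0) := by
  have hlim := (tendsto_rpow_nhdsGT_zero (one_half_pos (α := ℝ))).const_mul
    (Real.Gamma (1 - 1 / 2))
  rw [mul_zero] at hlim
  refine squeeze_zero_norm' ?_ hlim
  filter_upwards [self_mem_nhdsWithin] with y hy using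
    abs_besselMoment_zero_sub_one_le one_half_pos.le one_half_lt_one hy

lemma tendsto_log_mul_besselMoment_zero_sub_one :
    Tendsto (fun y => Real.log y * (besselMoment 0 y - 1)) (𝓝[>] 0) (𝓝 0) := by
  have hlim := (tendsto_log_mul_rpow_nhdsGT_zero (one_half_pos (α := ℝ))).norm.const_mul
    (Real.Gamma (1 - 1 / 2))
  rw [norm_zero, mul_zero] at hlim
  refine squeeze_zero_norm' ?_ hlim
  filter_upwards [self_mem_nhdsWithin] with y (hy : 0 < y)
  rw [norm_mul, norm_mul, mul_left_comm, Real.norm_of_nonneg (by positivity : 0 ≤ y ^ (1 / 2 : ℝ))]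
  gcongr
  exact abs_besselMoment_zero_sub_one_le one_half_pos.le one_half_lt_one hy

lemma tendsto_besselMoment_one_add_log :
    Tendsto (fun y => besselMoment 1 y + Real.log y) (𝓝[>] 0)
      (𝓝 (-(2 * Real.eulerMascheroniConstant))) := by
  have hlim := (tendsto_logBesselMoment.const_mul 2).sub tendsto_log_mul_besselMoment_zero_sub_one
  rw [sub_zero, mul_neg] at hlim
  refine hlim.congr' ?_
  filter_upwards [self_mem_nhdsWithin] with y hy
  rw [besselMoment_one_eq hy]
  ring

/-- The `l`-th term of the small-argument expansion of `besselMoment 0`, that is, of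
`2√y K₁(2√y) - 1`. -/
def besselLogTerm (l : ℕ) (y : ℝ) : ℝ :=
  y ^ (l + 1) / (l.factorial * (l + 1).factorial) *
    (Real.log y + 2 * Real.eulerMascheroniConstant - harmonic l - harmonic (l + 1))

/-- The derivative of `besselLogTerm l`. -/
def besselLogTermDeriv (l : ℕ) (y : ℝ) : ℝ :=
  y ^ l / (l.factorial : ℝ) ^ 2 *
    (Real.log y + 2 * Real.eulerMascheroniConstant - 2 * harmonic l)

lemma hasDerivAt_besselLogTerm (l : ℕ) {y : ℝ} (hy : y ≠ 0) :
    HasDerivAt (besselLogTerm l) (besselLogTermDeriv l y) y := by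
  have hprod := ((hasDerivAt_pow (l + 1) y).div_const (l.factorial * (l + 1).factorial : ℝ)).mul
    ((((Real.hasDerivAt_log hy).add_const (2 * Real.eulerMascheroniConstant)).sub_const
      (harmonic l : ℝ)).sub_const (harmonic (l + 1) : ℝ))
  refine hprod.congr_deriv ?_
  rw [besselLogTermDeriv, harmonic_succ, Nat.factorial_succ, add_tsub_cancel_right]
  push_cast
  field_simp
  ring

lemma hasDerivAt_besselLogTermDeriv_zero {y : ℝ} (hy : y ≠ 0) :
    HasDerivAt (besselLogTermDeriv 0) (1 / y) y := by
  have hfun : besselLogTermDeriv 0 = fun y => Real.log y + 2 * Real.eulerMascheroniConstant := by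
    ext y
    simp [besselLogTermDeriv]
  rw [hfun, one_div]
  exact (Real.hasDerivAt_log hy).add_const _

lemma hasDerivAt_besselLogTermDeriv_succ (l : ℕ) {y : ℝ} (hy : y ≠ 0) :
    HasDerivAt (besselLogTermDeriv (l + 1)) (besselLogTerm l y / y) y := by
  have hprod := ((hasDerivAt_pow (l + 1) y).div_const (((l + 1).factorial : ℝ) ^ 2)).mul
    (((Real.hasDerivAt_log hy).add_const (2 * Real.eulerMascheroniConstant)).sub_const
      (2 * harmonic (l + 1) : ℝ))
  refine hprod.congr_deriv ?_
  rw [besselLogTerm, harmonic_succ, Nat.factorial_succ, add_tsub_cancel_right]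
  push_cast
  field_simp
  ring

lemma tendsto_pow_succ_mul_log_add (n : ℕ) (c : ℝ) :
    Tendsto (fun y => y ^ (n + 1) * (Real.log y + c)) (𝓝[>] 0) (𝓝 0) := by
  have hn : (0 : ℝ) < (n + 1 : ℕ) := by positivity
  have hlim := (tendsto_log_mul_rpow_nhdsGT_zero hn).add
    ((tendsto_rpow_nhdsGT_zero hn).mul_const c)
  simp only [Real.rpow_natCast, zero_mul, add_zero] at hlim
  refine hlim.congr fun y => ?_
  ring

lemma tendsto_besselLogTerm (l : ℕ) : Tendsto (besselLogTerm l) (𝓝[>] 0) (𝓝 0) := by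
  have hlim := (tendsto_pow_succ_mul_log_add l
    (2 * Real.eulerMascheroniConstant - harmonic l - harmonic (l + 1))).div_const
    (l.factorial * (l + 1).factorial : ℝ)
  rw [zero_div] at hlim
  refine hlim.congr fun y => ?_
  rw [besselLogTerm]
  ring

lemma tendsto_besselLogTermDeriv_succ (l : ℕ) :
    Tendsto (besselLogTermDeriv (l + 1)) (𝓝[>] 0) (𝓝 0) := by
  have hlim := (tendsto_pow_succ_mul_log_add l
    (2 * Real.eulerMascheroniConstant - 2 * harmonic (l + 1))).div_const
    (((l + 1).factorial : ℝ) ^ 2)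
  rw [zero_div] at hlim
  refine hlim.congr fun y => ?_
  rw [besselLogTermDeriv]
  ring

/-- The error of the first `n` terms of the small-argument expansion of `besselMoment 0`. -/
def besselRemainder (n : ℕ) (y : ℝ) : ℝ :=
  besselMoment 0 y - 1 - ∑ l ∈ Finset.range n, besselLogTerm l y

/-- The derivative of `besselRemainder n`. -/
def besselRemainderDeriv (n : ℕ) (y : ℝ) : ℝ :=
  -besselMoment 1 y - ∑ l ∈ Finset.range n, besselLogTermDeriv l y

lemma hasDerivAt_besselRemainder (n : ℕ) {y : ℝ} (hy : 0 < y) :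
    HasDerivAt (besselRemainder n) (besselRemainderDeriv n y) y :=
  ((hasDerivAt_besselMoment 0 hy).sub_const 1).sub
    (HasDerivAt.fun_sum fun l _ => hasDerivAt_besselLogTerm l hy.ne')

lemma hasDerivAt_besselRemainderDeriv_succ (n : ℕ) {y : ℝ} (hy : 0 < y) :
    HasDerivAt (besselRemainderDeriv (n + 1)) (besselRemainder n y / y) y := by
  have hsum : HasDerivAt (fun y => ∑ l ∈ Finset.range (n + 1), besselLogTermDeriv l y)
      (∑ l ∈ Finset.range n, besselLogTerm l y / y + 1 / y) y := by
    simp only [Finset.sum_range_succ']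
    exact (HasDerivAt.fun_sum fun l _ => hasDerivAt_besselLogTermDeriv_succ l hy.ne').add
      (hasDerivAt_besselLogTermDeriv_zero hy.ne')
  refine ((hasDerivAt_besselMoment 1 hy).neg.sub hsum).congr_deriv ?_
  rw [besselRemainder, ← mul_besselMoment_two hy, ← Finset.sum_div]
  field_simp
  ring

lemma tendsto_besselRemainder (n : ℕ) : Tendsto (besselRemainder n) (𝓝[>] 0) (𝓝 0) := by
  have hlim := tendsto_besselMoment_zero_sub_one.sub
    (tendsto_finsetSum (Finset.range n) fun l _ => tendsto_besselLogTerm l)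
  rwa [Finset.sum_const_zero, sub_zero] at hlim

lemma tendsto_besselRemainderDeriv_succ (n : ℕ) :
    Tendsto (besselRemainderDeriv (n + 1)) (𝓝[>] 0) (𝓝 0) := by
  have hlim := (tendsto_besselMoment_one_add_log.neg.sub_const
    (2 * Real.eulerMascheroniConstant)).sub
    (tendsto_finsetSum (Finset.range n) fun l _ => tendsto_besselLogTermDeriv_succ l)
  rw [Finset.sum_const_zero, neg_neg, sub_self, sub_zero] at hlim
  refine hlim.congr fun y => ?_
  simp only [besselRemainderDeriv, Finset.sum_range_succ', besselLogTermDeriv, harmonic_zero,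
    pow_zero, Nat.factorial_zero, Nat.cast_one, one_pow, div_one, one_mul, Rat.cast_zero, mul_zero,
    sub_zero]
  ring

lemma abs_besselRemainder_le {a : ℝ} (ha : 0 < a) (ha' : a < 1) (n : ℕ) {y : ℝ} (hy : 0 < y) :
    |besselRemainder n y| ≤ Real.Gamma (1 - a) * Real.Gamma a * Real.Gamma (a + 1) /
      (Real.Gamma (a + n) * Real.Gamma (a + n + 1)) * y ^ (a + n) := by
  have hΓ : ∀ x, 0 < x → Real.Gamma x ≠ 0 := fun x hx => (Real.Gamma_pos_of_pos hx).ne'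
  induction n generalizing y with
  | zero =>
    have hΓa := hΓ a ha
    have hΓa' := hΓ (a + 1) (by linarith)
    rw [besselRemainder, Finset.sum_range_zero, sub_zero, Nat.cast_zero, add_zero, mul_assoc,
      mul_div_cancel_right₀ _ (mul_ne_zero hΓa hΓa')]
    exact abs_besselMoment_zero_sub_one_le ha.le ha' hy
  | succ n ih =>
    have han : 0 < a + n := by positivity
    refine (abs_le_rpow_of_mul_deriv_deriv_eq han
      (fun y hy => hasDerivAt_besselRemainder (n + 1) hy)
      (fun y hy => hasDerivAt_besselRemainderDeriv_succ n hy) (tendsto_besselRemainder (n + 1))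
      (tendsto_besselRemainderDeriv_succ n) (fun y hy => ih hy) hy).trans_eq ?_
    have hΓn := hΓ (a + n) han
    rw [Nat.cast_succ, ← add_assoc, Real.Gamma_add_one (s := a + n + 1) (by positivity),
      Real.Gamma_add_one (s := a + n) han.ne']
    field_simp

/-- The weight `e^{-sz} / (1+z)`, whose `n`-th moment on `(0, ∞)` is `n! Ψ(n+1, n+1; s)`. -/
def tricomiWeight (s z : ℝ) : ℝ := Real.exp (-(s * z)) / (1 + z)

lemma tricomiWeight_nonneg (s : ℝ) {z : ℝ} (hz : 0 ≤ z) : 0 ≤ tricomiWeight s z := by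
  unfold tricomiWeight
  positivity

lemma tricomiWeight_le_exp_neg (s : ℝ) {z : ℝ} (hz : 0 ≤ z) :
    tricomiWeight s z ≤ Real.exp (-(s * z)) :=
  div_le_self (Real.exp_pos _).le (by linarith)

lemma integrableOn_tricomiWeight_mul {s : ℝ} {f : ℝ → ℝ}
    (hf : IntegrableOn (fun z => Real.exp (-(s * z)) * f z) (Ioi 0)) :
    IntegrableOn (fun z => tricomiWeight s z * f z) (Ioi 0) := by
  have hmeas : AEStronglyMeasurable (fun z : ℝ => (1 + z)⁻¹) (volume.restrict (Ioi 0)) :=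
    Measurable.aestronglyMeasurable (by fun_prop)
  refine (Integrable.mono hf (hf.aestronglyMeasurable.mul hmeas) ?_).congr
    (Eventually.of_forall fun z => ?_)
  · filter_upwards [ae_restrict_mem measurableSet_Ioi] with z (hz : 0 < z)
    rw [Pi.mul_apply, norm_mul, Real.norm_of_nonneg (by positivity : 0 ≤ (1 + z)⁻¹)]
    exact mul_le_of_le_one_right (norm_nonneg _) (inv_le_one_of_one_le₀ (by linarith))
  · simp only [Pi.mul_apply, tricomiWeight]
    ring

lemma integrableOn_tricomiWeight_mul_pow {s : ℝ} (hs : 0 < s) (n : ℕ) :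
    IntegrableOn (fun z => tricomiWeight s z * z ^ n) (Ioi 0) := by
  refine integrableOn_tricomiWeight_mul ?_
  simpa only [Real.rpow_natCast] using
    integrableOn_exp_neg_mul_mul_rpow hs (a := n) (by linarith [n.cast_nonneg (α := ℝ)])

lemma integrableOn_tricomiWeight {s : ℝ} (hs : 0 < s) : IntegrableOn (tricomiWeight s) (Ioi 0) := by
  simpa only [pow_zero, mul_one] using integrableOn_tricomiWeight_mul_pow hs 0

lemma integrableOn_tricomiWeight_mul_pow_mul_log {s : ℝ} (hs : 0 < s) (n : ℕ) :
    IntegrableOn (fun z => tricomiWeight s z * (z ^ n * Real.log z)) (Ioi 0) := by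
  refine integrableOn_tricomiWeight_mul ?_
  simpa only [Real.rpow_natCast, mul_assoc] using
    integrableOn_exp_neg_mul_mul_rpow_mul_log hs (a := n) (by linarith [n.cast_nonneg (α := ℝ)])

lemma integral_tricomiWeight_mul_pow (s : ℝ) (n : ℕ) :
    ∫ z in Ioi (0 : ℝ), tricomiWeight s z * z ^ n
      = n.factorial * tricomiPsi (n + 1) (n + 1) s := by
  rw [tricomiPsi, Real.Gamma_nat_eq_factorial,
    mul_inv_cancel_left₀ (Nat.cast_ne_zero.2 n.factorial_ne_zero)]
  congr 1 with z
  simp only [tricomiWeight, add_sub_cancel_right, Real.rpow_natCast, sub_self, zero_sub,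
    Real.rpow_neg_one]
  ring

lemma integral_tricomiWeight (s : ℝ) :
    ∫ z in Ioi (0 : ℝ), tricomiWeight s z = tricomiPsi 1 1 s := by
  simpa only [pow_zero, mul_one, Nat.factorial_zero, Nat.cast_zero, Nat.cast_one, zero_add,
    one_mul] using integral_tricomiWeight_mul_pow s 0

lemma tricomiWeight_mul_besselLogTerm {A z : ℝ} (s : ℝ) (hA : 0 < A) (hz : 0 < z) (l : ℕ) :
    tricomiWeight s z * besselLogTerm l (A * z)
      = A ^ (l + 1) / (l.factorial * (l + 1).factorial) *
        ((Real.log A + 2 * Real.eulerMascheroniConstant - harmonic l - harmonic (l + 1))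
            * (tricomiWeight s z * z ^ (l + 1))
          + tricomiWeight s z * (z ^ (l + 1) * Real.log z)) := by
  rw [besselLogTerm, Real.log_mul hA.ne' hz.ne', mul_pow]
  ring

lemma integrableOn_tricomiWeight_mul_besselLogTerm {s A : ℝ} (hs : 0 < s) (hA : 0 < A) (l : ℕ) :
    IntegrableOn (fun z => tricomiWeight s z * besselLogTerm l (A * z)) (Ioi 0) := by
  refine IntegrableOn.congr_fun ?_
    (fun z hz => (tricomiWeight_mul_besselLogTerm s hA hz l).symm) measurableSet_Ioi
  exact (((integrableOn_tricomiWeight_mul_pow hs (l + 1)).const_mul _).add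
    (integrableOn_tricomiWeight_mul_pow_mul_log hs (l + 1))).const_mul _

lemma integral_tricomiWeight_mul_besselLogTerm {s A : ℝ} (hs : 0 < s) (hA : 0 < A) (l : ℕ) :
    ∫ z in Ioi (0 : ℝ), tricomiWeight s z * besselLogTerm l (A * z)
      = A ^ (l + 1) / l.factorial *
        ((Real.log A + 2 * Real.eulerMascheroniConstant - harmonic l - harmonic (l + 1))
          * tricomiPsi (l + 2) (l + 2) s
        + 1 / (l + 1).factorial *
          ∫ z in Ioi (0 : ℝ), tricomiWeight s z * (z ^ (l + 1) * Real.log z)) := by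
  have hmoment := integral_tricomiWeight_mul_pow s (l + 1)
  rw [Nat.cast_succ, add_assoc, one_add_one_eq_two] at hmoment
  rw [setIntegral_congr_fun measurableSet_Ioi fun z hz => tricomiWeight_mul_besselLogTerm s hA hz l,
    integral_const_mul, integral_add ((integrableOn_tricomiWeight_mul_pow hs (l + 1)).const_mul _)
    (integrableOn_tricomiWeight_mul_pow_mul_log hs (l + 1)), integral_const_mul, hmoment]
  field_simp

lemma integrableOn_tricomiWeight_mul_besselMoment {s A : ℝ} (hs : 0 < s) (hA : 0 < A) :
    IntegrableOn (fun z => tricomiWeight s z * besselMoment 0 (A * z)) (Ioi 0) := by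
  have hcont : ContinuousOn (fun z => besselMoment 0 (A * z)) (Ioi 0) := fun z hz =>
    (ContinuousAt.comp (f := fun z => A * z)
      (hasDerivAt_besselMoment 0 (mul_pos hA hz)).continuousAt
      (by fun_prop)).continuousWithinAt
  refine (integrableOn_tricomiWeight hs).mul_bdd
    (hcont.aestronglyMeasurable measurableSet_Ioi) (c := 1) ?_
  filter_upwards [ae_restrict_mem measurableSet_Ioi] with z (hz : 0 < z)
  rw [Real.norm_of_nonneg (besselMoment_zero_nonneg _)]
  exact besselMoment_zero_le_one (mul_pos hA hz)

lemma abs_integral_tricomiWeight_mul_le {f : ℝ → ℝ} {s p C : ℝ} (hs : 0 < s) (hp : -1 < p)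
    (hf : ∀ z, 0 < z → |f z| ≤ C * z ^ p) :
    |∫ z in Ioi (0 : ℝ), tricomiWeight s z * f z| ≤ C * (Real.Gamma (p + 1) / s ^ (p + 1)) := by
  have hGamma := Real.integral_rpow_mul_exp_neg_mul_Ioi (a := p + 1) (by linarith) hs
  rw [add_sub_cancel_right, one_div, Real.inv_rpow hs.le, ← div_eq_inv_mul] at hGamma
  simp only [mul_comm _ (Real.exp _)] at hGamma
  rw [← hGamma, ← integral_const_mul, ← Real.norm_eq_abs]
  refine norm_integral_le_of_norm_le ((integrableOn_exp_neg_mul_mul_rpow hs hp).const_mul C) ?_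
  filter_upwards [ae_restrict_mem measurableSet_Ioi] with z (hz : 0 < z)
  rw [norm_mul, Real.norm_of_nonneg (tricomiWeight_nonneg s hz.le), mul_left_comm]
  exact mul_le_mul (tricomiWeight_le_exp_neg s hz.le) (hf z hz) (abs_nonneg _) (Real.exp_pos _).le

lemma abs_integral_tricomiWeight_mul_besselRemainder_le {a s A : ℝ} (ha : 0 < a) (ha' : a < 1)
    (hs : 0 < s) (hA : 0 < A) (n : ℕ) :
    |∫ z in Ioi (0 : ℝ), tricomiWeight s z * besselRemainder n (A * z)|
      ≤ Real.Gamma (1 - a) * Real.Gamma a * Real.Gamma (a + 1) / s *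
        ((A / s) ^ (a + n) / Real.Gamma (a + n)) := by
  refine (abs_integral_tricomiWeight_mul_le (p := a + n)
    (C := Real.Gamma (1 - a) * Real.Gamma a * Real.Gamma (a + 1) /
      (Real.Gamma (a + n) * Real.Gamma (a + n + 1)) * A ^ (a + n)) hs (by linarith)
    fun z hz => ?_).trans_eq ?_
  · rw [mul_assoc, ← Real.mul_rpow hA.le hz.le]
    exact abs_besselRemainder_le ha ha' n (mul_pos hA hz)
  · rw [Real.div_rpow hA.le hs.le, Real.rpow_add_one hs.ne']
    field_simp

lemma integral_tricomiWeight_mul_besselRemainder {s A : ℝ} (hs : 0 < s) (hA : 0 < A) (n : ℕ) :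
    ∫ z in Ioi (0 : ℝ), tricomiWeight s z * besselRemainder n (A * z)
      = (∫ z in Ioi (0 : ℝ), tricomiWeight s z * besselMoment 0 (A * z)) - tricomiPsi 1 1 s
        - ∑ l ∈ Finset.range n,
            ∫ z in Ioi (0 : ℝ), tricomiWeight s z * besselLogTerm l (A * z) := by
  have hM := integrableOn_tricomiWeight_mul_besselMoment hs hA
  have hT := integrableOn_tricomiWeight_mul_besselLogTerm hs hA
  have hMw : IntegrableOn (fun z => tricomiWeight s z * besselMoment 0 (A * z) - tricomiWeight s z)
      (Ioi 0) := hM.sub (integrableOn_tricomiWeight hs)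
  have hexpand : ∀ z, tricomiWeight s z * besselRemainder n (A * z)
      = tricomiWeight s z * besselMoment 0 (A * z) - tricomiWeight s z
        - ∑ l ∈ Finset.range n, tricomiWeight s z * besselLogTerm l (A * z) := fun z => by
    rw [besselRemainder, mul_sub, mul_sub, mul_one, Finset.mul_sum]
  simp only [hexpand]
  rw [integral_sub hMw (integrable_finsetSum _ fun l _ => hT l),
    integral_sub hM (integrableOn_tricomiWeight hs), integral_finsetSum _ fun l _ => hT l,
    integral_tricomiWeight]

lemma hasSum_integral_tricomiWeight_mul_besselLogTerm {s A : ℝ} (hs : 0 < s) (hA : 0 < A) :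
    HasSum (fun l => ∫ z in Ioi (0 : ℝ), tricomiWeight s z * besselLogTerm l (A * z))
      ((∫ z in Ioi (0 : ℝ), tricomiWeight s z * besselMoment 0 (A * z)) - tricomiPsi 1 1 s) := by
  refine hasSum_of_abs_sub_sum_range_le
    ((summable_rpow_add_div_Gamma one_half_pos (div_pos hA hs)).mul_left
      (Real.Gamma (1 - 1 / 2) * Real.Gamma (1 / 2) * Real.Gamma (1 / 2 + 1) / s)) fun n => ?_
  rw [← integral_tricomiWeight_mul_besselRemainder hs hA]
  exact abs_integral_tricomiWeight_mul_besselRemainder_le one_half_pos one_half_lt_one hs hA n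

lemma lintegral_mul_comp_sq (f : ℝ → ENNReal) :
    ∫⁻ r in Ioi (0 : ℝ), ENNReal.ofReal (2 * r) * f (r ^ 2) = ∫⁻ x in Ioi (0 : ℝ), f x := by
  have himage : (fun r : ℝ => r ^ 2) '' Ioi 0 = Ioi 0 := by
    ext x
    refine ⟨?_, fun hx => ⟨√x, Real.sqrt_pos.2 hx, Real.sq_sqrt (le_of_lt hx)⟩⟩
    rintro ⟨r, hr, rfl⟩
    exact pow_pos (mem_Ioi.1 hr) 2
  have hchange := lintegral_image_eq_lintegral_abs_deriv_mul (f := fun r : ℝ => r ^ 2)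
    (f' := fun r => 2 * r) measurableSet_Ioi
    (fun r _ => ((hasDerivAt_pow 2 r).congr_deriv (by norm_num)).hasDerivWithinAt)
    (fun r hr t ht h => (pow_left_inj₀ (le_of_lt hr) (le_of_lt ht) two_ne_zero).1 h) f
  rw [himage] at hchange
  rw [hchange]
  refine setLIntegral_congr_fun measurableSet_Ioi fun r (hr : 0 < r) => ?_
  simp only [abs_of_pos (mul_pos two_pos hr)]

lemma lintegral_comp_norm_sq {f : ℝ → ENNReal} (hf : Measurable f) :
    ∫⁻ z : ℂ, f (‖z‖ ^ 2) = ENNReal.ofReal Real.pi * ∫⁻ x in Ioi (0 : ℝ), f x := by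
  rw [← Complex.lintegral_comp_polarCoord_symm, polarCoord_target, ← lintegral_mul_comp_sq,
    ← lintegral_const_mul _ (by fun_prop), Measure.volume_eq_prod, ← Measure.prod_restrict]
  simp only [Complex.norm_polarCoord_symm, sq_abs, smul_eq_mul]
  rw [lintegral_prod _ (by fun_prop)]
  refine setLIntegral_congr_fun measurableSet_Ioi fun r _ => ?_
  have hangle : volume (Ioo (-Real.pi) Real.pi) = ENNReal.ofReal Real.pi * ENNReal.ofReal 2 := by
    rw [Real.volume_Ioo, ← ENNReal.ofReal_mul Real.pi_pos.le]
    ring_nf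
  simp only [lintegral_const, Measure.restrict_apply_univ, hangle, ENNReal.ofReal_mul zero_le_two]
  ring

lemma gaussianPDF_mul_gaussianPDF (v : ℝ≥0) (x y : ℝ) :
    gaussianPDF 0 v x * gaussianPDF 0 v y
      = ENNReal.ofReal (Real.exp (-((x ^ 2 + y ^ 2) / (2 * v))) / (2 * Real.pi * v)) := by
  rw [gaussianPDF_def, ← ENNReal.ofReal_mul (gaussianPDFReal_nonneg _ _ _)]
  congr 1
  rw [gaussianPDFReal, gaussianPDFReal, mul_mul_mul_comm, ← Real.exp_add, ← mul_inv,
    Real.mul_self_sqrt (by positivity), div_eq_inv_mul (Real.exp _)]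
  congr 2
  ring

lemma lintegral_complexGaussian {v : ℝ≥0} (hv : 0 < v) {f : ℂ → ENNReal} (hf : Measurable f) :
    ∫⁻ z, f z ∂complexGaussian v
      = ∫⁻ z, ENNReal.ofReal (Real.exp (-(‖z‖ ^ 2 / v)) / (Real.pi * v)) * f z := by
  have hpdf := measurable_gaussianPDF 0 (v / 2)
  rw [complexGaussian, lintegral_map_equiv, gaussianReal_of_var_ne_zero _ (half_pos hv).ne',
    prod_withDensity hpdf hpdf,
    lintegral_withDensity_eq_lintegral_mul _ (by fun_prop) (by fun_prop),
    ← Complex.volume_preserving_equiv_real_prod.symm.lintegral_comp (by fun_prop)]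
  refine lintegral_congr fun p => ?_
  rw [Pi.mul_apply, gaussianPDF_mul_gaussianPDF, Complex.sq_norm, Complex.normSq_apply,
    Complex.measurableEquivRealProd_symm_apply, NNReal.coe_div, NNReal.coe_ofNat]
  congr 3 <;> ring_nf

lemma lintegral_expMeasure (r : ℝ) {f : ℝ → ENNReal} (hf : Measurable f) :
    ∫⁻ x, f x ∂expMeasure r
      = ∫⁻ x in Ioi (0 : ℝ), ENNReal.ofReal (r * Real.exp (-(r * x))) * f x := by
  have hpdf : Measurable (exponentialPDF r) := (measurable_exponentialPDFReal r).ennreal_ofReal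
  change ∫⁻ x, f x ∂volume.withDensity (exponentialPDF r) = _
  rw [lintegral_withDensity_eq_lintegral_mul _ hpdf hf, ← lintegral_indicator measurableSet_Ioi]
  refine lintegral_congr_ae ?_
  filter_upwards [Measure.ae_ne volume 0] with x hx
  rw [Pi.mul_apply]
  rcases hx.lt_or_gt with hneg | hpos
  · rw [exponentialPDF_of_neg hneg, indicator_of_notMem (notMem_Ioi.2 hneg.le), zero_mul]
  · rw [exponentialPDF_of_nonneg hpos.le, indicator_of_mem (mem_Ioi.2 hpos)]

lemma hasLaw_norm_sq_complexGaussian {v : ℝ≥0} (hv : 0 < v) :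
    HasLaw (fun z : ℂ => ‖z‖ ^ 2) (expMeasure (v : ℝ)⁻¹) (complexGaussian v) := by
  have hmeas : Measurable fun z : ℂ => ‖z‖ ^ 2 := by fun_prop
  refine ⟨hmeas.aemeasurable, Measure.ext_of_lintegral _ fun f hf => ?_⟩
  rw [lintegral_map hf hmeas, lintegral_complexGaussian hv (by fun_prop),
    lintegral_comp_norm_sq
      (f := fun x => ENNReal.ofReal (Real.exp (-(x / v)) / (Real.pi * v)) * f x) (by fun_prop),
    lintegral_expMeasure _ hf, ← lintegral_const_mul _ (by fun_prop)]
  refine lintegral_congr fun x => ?_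
  rw [← mul_assoc, ← ENNReal.ofReal_mul Real.pi_pos.le, ← div_eq_inv_mul, ← div_eq_inv_mul]
  congr 2
  field_simp

lemma expMeasure_Ioi {r t : ℝ} (hr : 0 < r) (ht : 0 ≤ t) :
    expMeasure r (Ioi t) = ENNReal.ofReal (Real.exp (-(r * t))) := by
  have := isProbabilityMeasure_expMeasure hr
  rw [← compl_Iic, prob_compl_eq_one_sub measurableSet_Iic, ← ofReal_cdf, cdf_expMeasure_eq hr,
    if_pos ht, ← ENNReal.ofReal_one,
    ← ENNReal.ofReal_sub _ (sub_nonneg.2 (Real.exp_le_one_iff.2 (neg_nonpos.2 (by positivity)))),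
    sub_sub_cancel]

lemma lintegral_ofReal_mul_besselKernel_comp_mul {α y : ℝ} (hα : 0 < α) (hy : 0 < y) :
    ∫⁻ x in Ioi (0 : ℝ), ENNReal.ofReal (α * besselKernel y (α * x))
      = ENNReal.ofReal (besselMoment 0 y) := by
  have hint : IntegrableOn (fun x => α * besselKernel y (α * x)) (Ioi 0) :=
    by
    have hcomp := (integrableOn_Ioi_comp_mul_left_iff (besselKernel y) 0 hα).2
      (by simpa only [mul_zero] using integrableOn_besselKernel hy)
    exact hcomp.const_mul α
  rw [← ofReal_integral_eq_lintegral_ofReal hint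
    (Eventually.of_forall fun x => mul_nonneg hα.le (besselKernel_pos y _).le),
    integral_const_mul, integral_comp_mul_left_Ioi _ 0 hα, mul_zero, smul_eq_mul,
    mul_inv_cancel_left₀ hα.ne', besselMoment_zero_eq]

lemma expMeasure_setOf_lt_mul_div {β b c t x : ℝ} (hβ : 0 < β) (hb : 0 ≤ b) (hc : 0 < c)
    (ht : 0 < t) (hx : 0 < x) :
    expMeasure β {y | t < x * y / (b * x + c)}
      = ENNReal.ofReal (Real.exp (-(β * b * t)) * Real.exp (-(β * c * t / x))) := by
  have hset : {y | t < x * y / (b * x + c)} = Ioi (t * (b * x + c) / x) := by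
    ext y
    rw [mem_ofPred_eq, mem_Ioi, lt_div_iff₀ (by positivity), div_lt_iff₀' hx]
  rw [hset, expMeasure_Ioi hβ (by positivity), ← Real.exp_add]
  congr 2
  field_simp
  ring

lemma expMeasure_prod_setOf_lt_mul_div {α β b c t : ℝ} (hα : 0 < α) (hβ : 0 < β) (hb : 0 ≤ b)
    (hc : 0 < c) (ht : 0 < t) :
    ((expMeasure α).prod (expMeasure β)) {p | t < p.1 * p.2 / (b * p.1 + c)}
      = ENNReal.ofReal (Real.exp (-(β * b * t)) * besselMoment 0 (α * β * c * t)) := by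
  have := isProbabilityMeasure_expMeasure hβ
  have hset : MeasurableSet {p : ℝ × ℝ | t < p.1 * p.2 / (b * p.1 + c)} :=
    measurableSet_lt (by fun_prop) (by fun_prop)
  rw [Measure.prod_apply hset, lintegral_expMeasure α (measurable_measure_prodMk_left hset),
    ENNReal.ofReal_mul (Real.exp_pos _).le,
    ← lintegral_ofReal_mul_besselKernel_comp_mul hα (by positivity),
    ← lintegral_const_mul _ (by fun_prop)]
  refine setLIntegral_congr_fun measurableSet_Ioi fun x (hx : 0 < x) => ?_
  simp only [preimage_ofPred_eq]
  rw [expMeasure_setOf_lt_mul_div hβ hb hc ht hx, ← ENNReal.ofReal_mul (by positivity),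
    ← ENNReal.ofReal_mul (by positivity), besselKernel, sub_eq_add_neg, Real.exp_add,
    mul_left_comm, mul_assoc α]
  congr 6
  field_simp

lemma intervalIntegrable_inv_one_add {x : ℝ} (hx : 0 ≤ x) :
    IntervalIntegrable (fun t : ℝ => (1 + t)⁻¹) volume 0 x := by
  refine ContinuousOn.intervalIntegrable (ContinuousOn.inv₀ (by fun_prop) fun t ht => ?_)
  rw [uIcc_of_le hx] at ht
  linarith [ht.1]

lemma integral_inv_one_add {x : ℝ} (hx : 0 ≤ x) :
    ∫ t in (0 : ℝ)..x, (1 + t)⁻¹ = Real.log (1 + x) := by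
  rw [intervalIntegral.integral_comp_add_left (fun t => t⁻¹) 1, add_zero,
    integral_inv_of_pos one_pos (by linarith), div_one]

section LayerCake

variable {S : Type*} [MeasurableSpace S] {μ : Measure S} {X : S → ℝ}

lemma lintegral_log_one_add (hX : AEMeasurable X μ) (hX0 : 0 ≤ᵐ[μ] X) :
    ∫⁻ ω, ENNReal.ofReal (Real.log (1 + X ω)) ∂μ
      = ∫⁻ t in Ioi (0 : ℝ), μ {ω | t < X ω} * ENNReal.ofReal (1 + t)⁻¹ := by
  rw [← lintegral_comp_eq_lintegral_meas_lt_mul μ hX0 hX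
    (fun t ht => intervalIntegrable_inv_one_add (le_of_lt ht))]
  · refine lintegral_congr_ae ?_
    filter_upwards [hX0] with ω hω
    rw [integral_inv_one_add hω]
  · filter_upwards [ae_restrict_mem measurableSet_Ioi] with t (ht : 0 < t)
    positivity

variable [IsFiniteMeasure μ]

lemma ofReal_integral_measureReal_lt_div_one_add
    (hint : IntegrableOn (fun t => μ.real {ω | t < X ω} / (1 + t)) (Ioi 0)) :
    ENNReal.ofReal (∫ t in Ioi (0 : ℝ), μ.real {ω | t < X ω} / (1 + t))
      = ∫⁻ t in Ioi (0 : ℝ), μ {ω | t < X ω} * ENNReal.ofReal (1 + t)⁻¹ := by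
  rw [ofReal_integral_eq_lintegral_ofReal hint]
  · refine lintegral_congr fun t => ?_
    rw [div_eq_mul_inv, ENNReal.ofReal_mul measureReal_nonneg, ofReal_measureReal]
  · filter_upwards [ae_restrict_mem measurableSet_Ioi] with t (ht : 0 < t)
    exact div_nonneg measureReal_nonneg (by positivity)

lemma integrable_log_one_add (hX : AEMeasurable X μ) (hX0 : 0 ≤ᵐ[μ] X)
    (hint : IntegrableOn (fun t => μ.real {ω | t < X ω} / (1 + t)) (Ioi 0)) :
    Integrable (fun ω => Real.log (1 + X ω)) μ := by
  refine ⟨(Real.measurable_log.comp_aemeasurable (hX.const_add 1)).aestronglyMeasurable, ?_⟩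
  rw [hasFiniteIntegral_iff_ofReal, lintegral_log_one_add hX hX0,
    ← ofReal_integral_measureReal_lt_div_one_add hint]
  · exact ENNReal.ofReal_lt_top
  · filter_upwards [hX0] with ω hω using Real.log_nonneg (le_add_of_nonneg_right hω)

lemma integral_log_one_add (hX : AEMeasurable X μ) (hX0 : 0 ≤ᵐ[μ] X)
    (hint : IntegrableOn (fun t => μ.real {ω | t < X ω} / (1 + t)) (Ioi 0)) :
    ∫ ω, Real.log (1 + X ω) ∂μ = ∫ t in Ioi (0 : ℝ), μ.real {ω | t < X ω} / (1 + t) := by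
  rw [integral_eq_lintegral_of_nonneg_ae _
    (integrable_log_one_add hX hX0 hint).aestronglyMeasurable, lintegral_log_one_add hX hX0,
    ← ofReal_integral_measureReal_lt_div_one_add hint, ENNReal.toReal_ofReal]
  · exact setIntegral_nonneg measurableSet_Ioi fun t ht =>
      div_nonneg measureReal_nonneg (by linarith [mem_Ioi.1 ht])
  · filter_upwards [hX0] with ω hω using Real.log_nonneg (le_add_of_nonneg_right hω)

end LayerCake

namespace TwoWayRelay

variable (T : TwoWayRelay)

lemma var_pos : 0 < T.var := T.noise_pos

lemma b_pos : 0 < T.b := by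
  have hnoise := T.noise_pos
  have hvarB := T.varB_nonneg
  have hlam := T.lam_pos
  have hlam' : 0 < 1 - T.lam := sub_pos.2 T.lam_lt_one
  unfold b eps
  positivity

lemma c_pos : 0 < T.c := one_div_pos.2 (mul_pos T.eta_pos T.lam_pos)

lemma chanVar_coe_pos (i : Fin 2) : (0 : ℝ) < T.chanVar i := T.chanVar_pos i

lemma psiArg_pos (i : Fin 2) : 0 < T.psiArg i :=
  div_pos (mul_pos T.var_pos T.b_pos) (mul_pos (T.P_pos i) (T.chanVar_coe_pos i))

lemma ratio_pos (i : Fin 2) : 0 < T.ratio i :=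
  div_pos (mul_pos T.var_pos T.c_pos)
    (mul_pos (mul_pos (T.P_pos i) (T.chanVar_coe_pos 0)) (T.chanVar_coe_pos 1))

lemma ratio_one_sub (i : Fin 2) :
    T.ratio (1 - i) = T.var * T.c / (T.P (1 - i) * T.chanVar i * T.chanVar (1 - i)) := by
  unfold ratio
  fin_cases i
  · rfl
  · exact congrArg _ (mul_right_comm _ _ _)

lemma snr_nonneg (i : Fin 2) (h : Fin 2 → ℂ) : 0 ≤ T.snr i h := by
  have hP := T.P_pos (1 - i)
  have hvar := T.var_pos
  have hb := T.b_pos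
  have hc := T.c_pos
  rw [snr_eq]
  positivity

lemma rate_eq (i : Fin 2) (h : Fin 2 → ℂ) :
    T.rate i h = 1 / (2 * Real.log 2) * Real.log (1 + T.snr i h) := by
  rw [rate, Real.logb]
  ring

lemma residualIntegrand_eq (i : Fin 2) (l : ℕ) (z : ℝ) :
    T.residualIntegrand i l z = tricomiWeight (T.psiArg i) z * (z ^ (l + 1) * Real.log z) := by
  rw [residualIntegrand, tricomiWeight]
  ring

lemma integrableOn_residualIntegrand (i : Fin 2) (l : ℕ) :
    IntegrableOn (T.residualIntegrand i l) (Ioi 0) := by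
  simpa only [← residualIntegrand_eq] using
    integrableOn_tricomiWeight_mul_pow_mul_log (T.psiArg_pos i) (l + 1)

lemma integral_tricomiWeight_mul_besselLogTerm_eq_seriesTerm (i : Fin 2) (l : ℕ) :
    ∫ z in Ioi (0 : ℝ), tricomiWeight (T.psiArg i) z * besselLogTerm l (T.ratio i * z)
      = T.seriesTerm i l := by
  have hharmonic : ∀ n : ℕ, (harmonic n : ℝ) = ∑ k ∈ Finset.Icc 1 n, 1 / (k : ℝ) := fun n => by
    rw [harmonic_eq_sum_Icc]
    push_cast
    simp only [one_div]
  rw [integral_tricomiWeight_mul_besselLogTerm (T.psiArg_pos i) (T.ratio_pos i), seriesTerm,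
    hharmonic, hharmonic]
  simp only [residualIntegral, residualIntegrand_eq]

lemma hasSum_seriesTerm (i : Fin 2) :
    HasSum (T.seriesTerm i) ((∫ z in Ioi (0 : ℝ),
      tricomiWeight (T.psiArg i) z * besselMoment 0 (T.ratio i * z))
        - tricomiPsi 1 1 (T.psiArg i)) := by
  simpa only [integral_tricomiWeight_mul_besselLogTerm_eq_seriesTerm] using
    hasSum_integral_tricomiWeight_mul_besselLogTerm (T.psiArg_pos i) (T.ratio_pos i)

lemma seriesTerm_zero (i : Fin 2) :
    T.seriesTerm i 0 = T.ratio i * (Real.log (T.ratio i) + 2 * Real.eulerMascheroniConstant - 1)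
      * tricomiPsi 2 2 (T.psiArg i) + T.ratio i * T.residualIntegral i 0 := by
  simp only [seriesTerm, zero_add, pow_one, Nat.factorial_zero, Nat.factorial_one, Nat.cast_zero,
    Nat.cast_one, div_one, one_mul, Finset.Icc_eq_empty_of_lt one_pos, Finset.sum_empty, sub_zero,
    Finset.Icc_self, Finset.sum_singleton]
  ring

section Fading

variable {S : Type*} [MeasurableSpace S] {μ : Measure S} {h : Fin 2 → S → ℂ}

lemma aemeasurable_snr (hmeas : ∀ i, AEMeasurable (h i) μ) (i : Fin 2) :
    AEMeasurable (fun ω => T.snr i fun k => h k ω) μ := by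
  simp only [snr_eq]
  fun_prop

variable [IsProbabilityMeasure μ] (hlaw : ∀ i, HasLaw (h i) (complexGaussian (T.chanVar i)) μ)
  (hindep : IndepFun (h 0) (h 1) μ)

include hlaw hindep

lemma hasLaw_norm_sq_prodMk (i : Fin 2) :
    HasLaw (fun ω => (‖h i ω‖ ^ 2, ‖h (1 - i) ω‖ ^ 2))
      ((expMeasure (T.chanVar i : ℝ)⁻¹).prod (expMeasure (T.chanVar (1 - i) : ℝ)⁻¹)) μ := by
  have hind : IndepFun (h i) (h (1 - i)) μ := by
    fin_cases i
    · exact hindep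
    · exact hindep.symm
  have hgain : ∀ k, HasLaw (fun ω => ‖h k ω‖ ^ 2) (expMeasure (T.chanVar k : ℝ)⁻¹) μ := fun k =>
    (hasLaw_norm_sq_complexGaussian (T.chanVar_pos k)).fun_comp (hlaw k)
  have hnorm : Measurable fun z : ℂ => ‖z‖ ^ 2 := by fun_prop
  exact (hind.comp hnorm hnorm).hasLaw_prod (hgain i) (hgain (1 - i))

lemma measureReal_lt_snr (i : Fin 2) {t : ℝ} (ht : 0 < t) :
    μ.real {ω | t < T.snr i fun k => h k ω}
      = Real.exp (-(T.psiArg (1 - i) * t)) * besselMoment 0 (T.ratio (1 - i) * t) := by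
  have hgain : 0 < T.P (1 - i) / T.var := div_pos (T.P_pos _) T.var_pos
  have hevent : {ω | t < T.snr i fun k => h k ω} = {ω | t / (T.P (1 - i) / T.var)
      < ‖h i ω‖ ^ 2 * ‖h (1 - i) ω‖ ^ 2 / (T.b * ‖h i ω‖ ^ 2 + T.c)} := by
    ext ω
    rw [mem_ofPred_eq, mem_ofPred_eq, snr_eq, div_lt_iff₀' hgain]
  rw [hevent, measureReal_def, (T.hasLaw_norm_sq_prodMk hlaw hindep i).measure_eq
      (p := fun p => t / (T.P (1 - i) / T.var) < p.1 * p.2 / (T.b * p.1 + T.c))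
      (measurableSet_lt (by fun_prop) (by fun_prop)),
    expMeasure_prod_setOf_lt_mul_div (inv_pos.2 (T.chanVar_coe_pos i))
      (inv_pos.2 (T.chanVar_coe_pos (1 - i))) T.b_pos.le T.c_pos (div_pos ht hgain),
    ENNReal.toReal_ofReal (mul_nonneg (Real.exp_pos _).le (besselMoment_zero_nonneg _)),
    ratio_one_sub, psiArg]
  congr 2 <;> field_simp

lemma measureReal_lt_snr_div_one_add (i : Fin 2) {t : ℝ} (ht : 0 < t) :
    μ.real {ω | t < T.snr i fun k => h k ω} / (1 + t)
      = tricomiWeight (T.psiArg (1 - i)) t * besselMoment 0 (T.ratio (1 - i) * t) := by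
  rw [T.measureReal_lt_snr hlaw hindep i ht, tricomiWeight, div_mul_eq_mul_div]

lemma integrableOn_measureReal_lt_snr_div_one_add (i : Fin 2) :
    IntegrableOn (fun t => μ.real {ω | t < T.snr i fun k => h k ω} / (1 + t)) (Ioi 0) :=
  (integrableOn_tricomiWeight_mul_besselMoment (T.psiArg_pos _) (T.ratio_pos _)).congr_fun
    (fun _ ht => (T.measureReal_lt_snr_div_one_add hlaw hindep i ht).symm) measurableSet_Ioi

lemma integrable_rate (i : Fin 2) : Integrable (fun ω => T.rate i fun k => h k ω) μ := by
  simp only [rate_eq]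
  exact (integrable_log_one_add (T.aemeasurable_snr (fun k => (hlaw k).aemeasurable) i)
    (Eventually.of_forall fun ω => T.snr_nonneg i _)
    (T.integrableOn_measureReal_lt_snr_div_one_add hlaw hindep i)).const_mul _

lemma integral_rate (i : Fin 2) :
    ∫ ω, T.rate i (fun k => h k ω) ∂μ = 1 / (2 * Real.log 2) *
      (tricomiPsi 1 1 (T.psiArg (1 - i)) + ∑' l, T.seriesTerm (1 - i) l) := by
  simp only [rate_eq]
  rw [integral_const_mul,
    integral_log_one_add (T.aemeasurable_snr (fun k => (hlaw k).aemeasurable) i)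
      (Eventually.of_forall fun ω => T.snr_nonneg i _)
      (T.integrableOn_measureReal_lt_snr_div_one_add hlaw hindep i),
    setIntegral_congr_fun measurableSet_Ioi fun t ht =>
      T.measureReal_lt_snr_div_one_add hlaw hindep i ht,
    (T.hasSum_seriesTerm (1 - i)).tsum_eq, add_sub_cancel]

lemma ergodicCapacity_eq : T.ergodicCapacity μ h = 1 / (2 * Real.log 2) *
    ∑ i, (tricomiPsi 1 1 (T.psiArg i) + ∑' l, T.seriesTerm i l) := by
  simp only [ergodicCapacity, T.integral_rate hlaw hindep]
  rw [← Finset.mul_sum]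
  exact congrArg _ (Equiv.sum_comp (Equiv.subLeft 1) fun i =>
    tricomiPsi 1 1 (T.psiArg i) + ∑' l, T.seriesTerm i l)

end Fading

end TwoWayRelay

end

theorem theorem2 {S : Type*} [MeasurableSpace S] (μ : Measure S) [IsProbabilityMeasure μ]
    (T : TwoWayRelay) (h : Fin 2 → S → ℂ)
    (hlaw : ∀ i, HasLaw (h i) (complexGaussian (T.chanVar i)) μ)
    (hindep : IndepFun (h 0) (h 1) μ) :
    (∀ i, Integrable (fun ω => T.rate i (fun k => h k ω)) μ) ∧
    (∀ i l, IntegrableOn (T.residualIntegrand i l) (Set.Ioi 0)) ∧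
    (∀ i, Summable (fun l : ℕ => T.seriesTerm i (l + 1))) ∧
    T.ergodicCapacity μ h =
      1 / (2 * Real.log 2) * ∑ i : Fin 2, tricomiPsi 1 1 (T.psiArg i)
      + 1 / (2 * Real.log 2) * ∑ i : Fin 2,
          ((∑' l : ℕ, T.seriesTerm i (l + 1))
            + T.ratio i * (Real.log (T.ratio i) + 2 * Real.eulerMascheroniConstant - 1)
                * tricomiPsi 2 2 (T.psiArg i)
            + T.ratio i * T.residualIntegral i 0) := by
  refine ⟨fun i => T.integrable_rate hlaw hindep i, fun i l => T.integrableOn_residualIntegrand i l,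
    fun i => (summable_nat_add_iff 1).2 (T.hasSum_seriesTerm i).summable, ?_⟩
  have hseries : ∀ i, ∑' l, T.seriesTerm i l = (∑' l, T.seriesTerm i (l + 1))
      + T.ratio i * (Real.log (T.ratio i) + 2 * Real.eulerMascheroniConstant - 1)
        * tricomiPsi 2 2 (T.psiArg i) + T.ratio i * T.residualIntegral i 0 := fun i => by
    rw [(T.hasSum_seriesTerm i).summable.tsum_eq_zero_add, T.seriesTerm_zero]
    ring
  simp only [T.ergodicCapacity_eq hlaw hindep, Finset.sum_add_distrib, mul_add, hseries]
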